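/- An \emph{mm-space} is a complete separable metric space $(X,d_X)$ with a Borel probability measure $\mu_X$; two mm-spaces are \emph{isomorphic} if there is a bijective isometry between the supports of their measures that carries one measure to the other, and $\mathcal X$ is the set of isomorphism classes. Relations between classes below are understood to hold for some choice of representatives. Write $Y\prec X$ if there is a $1$-Lipschitz map $f:X\to Y$ with $f_*\mu_X=\mu_Y$. For $\varepsilon>0$ write $Y\prec_\varepsilon X$ if there are a Borel set $\tilde X\subset X$ and a Borel map $f:X\to Y$ with $\mu_X(\tilde X)\ge 1-\varepsilon$, $d_Y(f(x),f(x'))\le d_X(x,x')+\varepsilon$ for all $x,x'\in\tilde X$, and $d_P(f_*\mu_X,\mu_Y)\le\varepsilon$, where $d_P$ is the Prohorov distance. Let $I=[0,1)$ with Lebesgue measure $\mathcal L$. The \emph{box distance} $\Box(X,Y)$ is the infimum of all $\varepsilon\ge 0$ for which there are Borel maps $\varphi:I\to X$, $\psi:I\to Y$ with $\varphi_*\mathcal L=\mu_X$, $\psi_*\mathcal L=\mu_Y$, and a Borel set $I_0\subset I$ with $\mathcal L(I_0)\ge 1-\varepsilon$ and $|d_X(\varphi(s),\varphi(t))-d_Y(\psi(s),\psi(t))|\le\varepsilon$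 for all $s,t\in I_0$. It is a metric on $\mathcal X$. For $\mathcal P\subset\mathcal X$ put $\Box(X,\mathcal P)=\inf_{Y\in\mathcal P}\Box(X,Y)$. A \emph{pyramid} is a non-empty closed set $\mathcal P\subset(\mathcal X,\Box)$ such that (i) $X\in\mathcal P$ and $Y\prec X$ imply $Y\in\mathcal P$; (ii) for all $X,Y\in\mathcal P$ there is $Z\in\mathcal P$ with $X\prec Z$ and $Y\prec Z$. A sequence of pyramids $\mathcal P_n$ \emph{converges weakly} to a pyramid $\mathcal P$ if $\lim_{n\to\infty}\Box(X,\mathcal P_n)=0$ for every $X\in\mathcal P$ and $\liminf_{n\to\infty}\Box(Y,\mathcal P_n)>0$ for every $Y\in\mathcal X\setminus\mathcal P$. For pyramids $\mathcal P,\mathcal Q$ write $\mathcal Q\prec_\varepsilon\mathcal P$ if every $Y\in\mathcal Q$ admits $X\in\mathcal P$ with $Y\prec_\varepsilon X$. \textbf{Proposition.} Let $(\varepsilon_n)_{n}$ be a sequence of positive numbers with $\varepsilon_n\to 0$. If sequences $(\mathcal P_n)_n$ and $(\mathcal Q_n)_n$ of pyramids converge weakly to pyramids $\mathcal P$ and $\mathcal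 Q$ respectively, and $\mathcal Q_n\prec_{\varepsilon_n}\mathcal P_n$ for every $n$, then $\mathcal Q\subset\mathcal P$. -/

import Mathlib

open MeasureTheory Filter Topology
open scoped ENNReal NNReal

/-- An mm-space: a complete separable metric space with a Borel probability measure.
Every such space has at most continuum many points, so `Type` is large enough. -/
structure MMSpace : Type 1 where
  carrier : Type
  [metric : MetricSpace carrier]
  [complete : CompleteSpace carrier]
  [separable : TopologicalSpace.SeparableSpace carrier]
  [measurable : MeasurableSpace carrier]
  [borel : BorelSpace carrier]
  μ : Measure carrier
  [prob : IsProbabilityMeasure μ]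

namespace MMSpace

instance : CoeSort MMSpace Type := ⟨MMSpace.carrier⟩

attribute [instance] metric complete separable measurable borel prob

/-- The restriction of `μ` to its support, as a measure on the support. -/
noncomputable def suppMeasure (X : MMSpace) : Measure X.μ.support :=
  X.μ.comap Subtype.val

/-- mm-isomorphism: a measure preserving isometry between the supports of the measures. -/
def Iso (X Y : MMSpace) : Prop :=
  ∃ f : X.μ.support ≃ᵢ Y.μ.support, MeasurePreserving f X.suppMeasure Y.suppMeasure

theorem Iso.refl (X : MMSpace) : Iso X X :=
  ⟨IsometryEquiv.refl _, MeasurePreserving.id _⟩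

theorem Iso.symm {X Y : MMSpace} : Iso X Y → Iso Y X := by
  rintro ⟨f, hf⟩
  exact ⟨f.symm, MeasurePreserving.symm f.toHomeomorph.toMeasurableEquiv hf⟩

theorem Iso.trans {X Y Z : MMSpace} : Iso X Y → Iso Y Z → Iso X Z := by
  rintro ⟨f, hf⟩ ⟨g, hg⟩
  exact ⟨f.trans g, hg.comp hf⟩

instance isoSetoid : Setoid MMSpace where
  r := Iso
  iseqv := ⟨Iso.refl, Iso.symm, Iso.trans⟩

/-- `Y ≺ X`: the Lipschitz order, `X` dominates `Y`. -/
def Dominated (Y X : MMSpace) : Prop :=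
  ∃ f : X → Y, LipschitzWith 1 f ∧ X.μ.map f = Y.μ

/-- `Y ≺_ε X`: domination up to an additive error `ε`. -/
def ApproxDominated (ε : ℝ) (Y X : MMSpace) : Prop :=
  ∃ (X' : Set X) (f : X → Y), MeasurableSet X' ∧ Measurable f ∧
    1 - ε ≤ X.μ.real X' ∧
    (∀ x ∈ X', ∀ x' ∈ X', dist (f x) (f x') ≤ dist x x' + ε) ∧
    levyProkhorovDist (X.μ.map f) Y.μ ≤ ε

/-- The parameter interval `[0, 1)`. -/
abbrev ParamInterval : Type := Set.Ico (0 : ℝ) 1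

/-- Lebesgue measure on `[0, 1)`. -/
noncomputable def leb : Measure ParamInterval := (volume : Measure ℝ).comap Subtype.val

/-- A parameter of `X`: a Borel map from `[0, 1)` pushing Lebesgue measure to `μ`. -/
def IsParameter (X : MMSpace) (φ : ParamInterval → X) : Prop :=
  Measurable φ ∧ leb.map φ = X.μ

/-- The box distance between two (pseudo-)metrics on `[0, 1)`: the infimum of the `ε ≥ 0` such
that they differ by at most `ε` on a Borel set of Lebesgue measure at least `1 - ε`. -/
noncomputable def boxParam (ρ₁ ρ₂ : ParamInterval → ParamInterval → ℝ) : ℝ≥0∞ :=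
  ⨅ ε ∈ {ε : ℝ≥0 | ∃ I₀ : Set ParamInterval, MeasurableSet I₀ ∧
      (∀ s ∈ I₀, ∀ t ∈ I₀, |ρ₁ s t - ρ₂ s t| ≤ ε) ∧
      1 - (ε : ℝ) ≤ leb.real I₀}, (ε : ℝ≥0∞)

/-- The box distance of mm-spaces: the infimum over all parameters of both spaces. -/
noncomputable def box (X Y : MMSpace) : ℝ≥0∞ :=
  ⨅ (φ : ParamInterval → X) (_ : X.IsParameter φ)
    (ψ : ParamInterval → Y) (_ : Y.IsParameter ψ),
    boxParam (fun s t => dist (φ s) (φ t)) (fun s t => dist (ψ s) (ψ t))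

end MMSpace

/-- The set `𝒳` of mm-isomorphism classes of mm-spaces. -/
def MMClass : Type 1 := Quotient MMSpace.isoSetoid

namespace MMClass

/-- The class of an mm-space. -/
def mk (X : MMSpace) : MMClass := Quotient.mk MMSpace.isoSetoid X

/-- `b ≺ a` for classes: it holds for some representatives. (A map defined on the support need not
extend to the whole space, so one has to be free to take, say, a representative of full support.) -/
def Dominated (b a : MMClass) : Prop :=
  ∃ Y X : MMSpace, mk Y = b ∧ mk X = a ∧ Y.Dominated X

/-- `b ≺_ε a` for classes: it holds for some representatives. -/
def ApproxDominated (ε : ℝ) (b a : MMClass) : Prop :=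
  ∃ Y X : MMSpace, mk Y = b ∧ mk X = a ∧ MMSpace.ApproxDominated ε Y X

/-- The box distance on classes (it does not depend on the representatives). -/
noncomputable def box (a b : MMClass) : ℝ≥0∞ :=
  ⨅ (X : MMSpace) (_ : mk X = a) (Y : MMSpace) (_ : mk Y = b), X.box Y

/-- The topology of the box distance: a set is open if it contains a box ball around each of its
points. -/
instance : TopologicalSpace MMClass where
  IsOpen U := ∀ a ∈ U, ∃ r : ℝ≥0∞, 0 < r ∧ ∀ b, box a b < r → b ∈ U
  isOpen_univ := fun _ _ => ⟨1, one_pos, fun _ _ => trivial⟩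
  isOpen_inter := by
    rintro U V hU hV a ⟨haU, haV⟩
    obtain ⟨r, hr, hrU⟩ := hU a haU
    obtain ⟨s, hs, hsV⟩ := hV a haV
    exact ⟨min r s, lt_min hr hs, fun b hb =>
      ⟨hrU b (hb.trans_le (min_le_left _ _)), hsV b (hb.trans_le (min_le_right _ _))⟩⟩
  isOpen_sUnion := by
    rintro S hS a ⟨U, hU, haU⟩
    obtain ⟨r, hr, hrU⟩ := hS U hU a haU
    exact ⟨r, hr, fun b hb => ⟨U, hU, hrU b hb⟩⟩

/-- The distance from a class to a set of classes. -/
noncomputable def boxToSet (a : MMClass) (P : Set MMClass) : ℝ≥0∞ :=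
  ⨅ b ∈ P, box a b

end MMClass

/-- Pyramids. -/
structure IsPyramid (P : Set MMClass) : Prop where
  nonempty : P.Nonempty
  isClosed : IsClosed P
  downward : ∀ a ∈ P, ∀ b : MMClass, b.Dominated a → b ∈ P
  directed : ∀ a ∈ P, ∀ b ∈ P, ∃ c ∈ P, a.Dominated c ∧ b.Dominated c

/-- Weak convergence of pyramids. -/
def WeaklyConverges (P : ℕ → Set MMClass) (Plim : Set MMClass) : Prop :=
  (∀ a ∈ Plim, Tendsto (fun n => a.boxToSet (P n)) atTop (𝓝 0)) ∧
  (∀ b ∉ Plim, 0 < liminf (fun n => b.boxToSet (P n)) atTop)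

/-- `Q ≺_ε P` for pyramids. -/
def PyramidApproxDominated (ε : ℝ) (Q P : Set MMClass) : Prop :=
  ∀ b ∈ Q, ∃ a ∈ P, MMClass.ApproxDominated ε b a

/-! Argue by contradiction, with the class of `Y` in `Qlim` but not in `Plim`. Distances to finitely
many points of a dense sequence give a `1`-Lipschitz `F : Y → ℓ^∞_N` whose image `Z` is box-close to
`Y` (`exists_box_lipschitzImage_le`). Since `Plim` is closed, `Z` can be kept outside it, so `Z`
stays at box distance more than some `c > 0` from `P n` for all large `n`.

On the other hand, `Q n` contains some `Y'` close to `Y`, and `Y'` is approximately dominated by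
some `X` in `P n`. McShane's extension formula, applied coordinatewise, replaces an almost
`1`-Lipschitz map into `ℓ^∞_N` by a truly `1`-Lipschitz one nearby. It carries `F` from `Y` to `Y'`
and then to `X`, giving `G : X → ℓ^∞_N` whose law is Prokhorov-close to that of `F`
(`ApproxDominated.exists_lipschitzWith_map_le`). The image of `X` under `G` lies in `P n` by
downward closure.

Finally, Prokhorov-close laws on one space are box-close (`exists_forall_leb_map_eq_dist_le`), so
the image of `X` is within `c` of `Z`, a contradiction. As the law of `F` is fixed, the closeness
needed may depend on it; an explicit coupling over finitely many compact sets then suffices. -/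

/-! ### Couplings of finite measures -/

section Coupling

variable {E F : Type*} [MeasurableSpace E] [MeasurableSpace F]

/-- Two finite measures of the same mass have a coupling. -/
theorem exists_coupling_of_mass_eq (μ : Measure E) (ν : Measure F) [IsFiniteMeasure μ]
    [IsFiniteMeasure ν] (h : μ Set.univ = ν Set.univ) :
    ∃ π : Measure (E × F), π.map Prod.fst = μ ∧ π.map Prod.snd = ν := by
  rcases eq_or_ne (μ Set.univ) 0 with h0 | h0
  · refine ⟨0, ?_, ?_⟩
    · rw [Measure.measure_univ_eq_zero.1 h0, Measure.map_zero]
    · rw [Measure.measure_univ_eq_zero.1 (h.symm.trans h0), Measure.map_zero]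
  · refine ⟨(μ Set.univ)⁻¹ • μ.prod ν, ?_, ?_⟩
    · rw [Measure.map_smul, Measure.map_fst_prod, ← h, smul_smul,
        ENNReal.inv_mul_cancel h0 (measure_ne_top _ _), one_smul]
    · rw [Measure.map_smul, Measure.map_snd_prod, smul_smul,
        ENNReal.inv_mul_cancel h0 (measure_ne_top _ _), one_smul]

/-- A coupling of smaller measures extends to a coupling of the larger ones. -/
theorem exists_coupling_ge {μ μ' : Measure E} {ν ν' : Measure F} [IsFiniteMeasure μ]
    [IsFiniteMeasure ν] (h : μ Set.univ = ν Set.univ) (hμ : μ' ≤ μ) (hν : ν' ≤ ν)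
    {π' : Measure (E × F)} (h₁ : π'.map Prod.fst = μ') (h₂ : π'.map Prod.snd = ν') :
    ∃ π : Measure (E × F), π' ≤ π ∧ π.map Prod.fst = μ ∧ π.map Prod.snd = ν := by
  have : IsFiniteMeasure μ' := isFiniteMeasure_of_le μ hμ
  have : IsFiniteMeasure ν' := isFiniteMeasure_of_le ν hν
  have hmass : μ' Set.univ = ν' Set.univ := by
    rw [← h₁, ← h₂, Measure.map_apply measurable_fst .univ, Measure.map_apply measurable_snd .univ]
    rfl
  have : IsFiniteMeasure (μ - μ') := isFiniteMeasure_of_le μ Measure.sub_le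
  have : IsFiniteMeasure (ν - ν') := isFiniteMeasure_of_le ν Measure.sub_le
  -- The remainders have equal mass, so they can be coupled independently of `π'`.
  obtain ⟨π, hπ₁, hπ₂⟩ := exists_coupling_of_mass_eq (μ - μ') (ν - ν') (by
    rw [Measure.sub_apply .univ hμ, Measure.sub_apply .univ hν, h, hmass])
  refine ⟨π + π', Measure.le_add_left le_rfl, ?_, ?_⟩
  · rw [Measure.map_add _ _ measurable_fst, hπ₁, h₁, Measure.sub_add_cancel_of_le hμ]
  · rw [Measure.map_add _ _ measurable_snd, hπ₂, h₂, Measure.sub_add_cancel_of_le hν]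

/-- Scaling down the restriction of a measure to a set so that it has a prescribed mass. -/
theorem exists_le_restrict_mass_eq (μ : Measure E) [IsFiniteMeasure μ] {K : Set E} {c : ℝ≥0∞}
    (hc : c ≤ μ K) : ∃ μ' : Measure E, μ' ≤ μ.restrict K ∧ μ' Set.univ = c := by
  refine ⟨(c / μ K) • μ.restrict K, ?_, ?_⟩
  · refine Measure.le_iff.2 fun s _ => ?_
    rw [Measure.smul_apply, smul_eq_mul]
    exact mul_le_of_le_one_left' (ENNReal.div_le_of_le_mul (by rwa [one_mul]))
  · rw [Measure.smul_apply, smul_eq_mul, Measure.restrict_apply_univ]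
    exact ENNReal.div_mul_cancel' (fun h => le_antisymm (h ▸ hc) zero_le)
      (fun h => absurd h (measure_ne_top _ _))

theorem sum_restrict_le_of_pairwise_disjoint {ι : Type*} [Fintype ι] (μ : Measure E)
    {K : ι → Set E} (hK : ∀ i, MeasurableSet (K i)) (hd : Pairwise (Function.onFun Disjoint K)) :
    ∑ i, μ.restrict (K i) ≤ μ := by
  rw [← Measure.sum_fintype, ← Measure.restrict_iUnion hd hK]
  exact Measure.restrict_le_self

/-- Given disjoint sets `K i` and disjoint sets `U i`, two probability measures can be coupled so
that the mass of `K i` is transported to `U i` as far as possible. -/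
theorem exists_coupling_sum_min_le {ι : Type*} [Fintype ι] (μ : Measure E) (ν : Measure F)
    [IsProbabilityMeasure μ] [IsProbabilityMeasure ν] {K : ι → Set E} {U : ι → Set F}
    (hK : ∀ i, MeasurableSet (K i)) (hU : ∀ i, MeasurableSet (U i))
    (hKd : Pairwise (Function.onFun Disjoint K)) (hUd : Pairwise (Function.onFun Disjoint U)) :
    ∃ π : Measure (E × F), π.map Prod.fst = μ ∧ π.map Prod.snd = ν ∧
      ∑ i, min (μ (K i)) (ν (U i)) ≤ π (⋃ i, K i ×ˢ U i) := by
  choose μ' hμ' hμc using fun i => exists_le_restrict_mass_eq μ (min_le_left (μ (K i)) (ν (U i)))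
  choose ν' hν' hνc using fun i => exists_le_restrict_mass_eq ν (min_le_right (μ (K i)) (ν (U i)))
  have fμ : ∀ i, IsFiniteMeasure (μ' i) := fun i => isFiniteMeasure_of_le _ (hμ' i)
  have fν : ∀ i, IsFiniteMeasure (ν' i) := fun i => isFiniteMeasure_of_le _ (hν' i)
  choose ρ hρ₁ hρ₂ using fun i =>
    exists_coupling_of_mass_eq (μ' i) (ν' i) ((hμc i).trans (hνc i).symm)
  have hmap₁ : (∑ i, ρ i).map Prod.fst = ∑ i, μ' i := by
    rw [← Measure.sum_fintype, Measure.map_sum measurable_fst.aemeasurable, Measure.sum_fintype]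
    simp only [hρ₁]
  have hmap₂ : (∑ i, ρ i).map Prod.snd = ∑ i, ν' i := by
    rw [← Measure.sum_fintype, Measure.map_sum measurable_snd.aemeasurable, Measure.sum_fintype]
    simp only [hρ₂]
  obtain ⟨π, hπ, hπ₁, hπ₂⟩ := exists_coupling_ge (μ := μ) (ν := ν) (by simp)
    ((Finset.sum_le_sum fun i _ => hμ' i).trans (sum_restrict_le_of_pairwise_disjoint μ hK hKd))
    ((Finset.sum_le_sum fun i _ => hν' i).trans (sum_restrict_le_of_pairwise_disjoint ν hU hUd))
    hmap₁ hmap₂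
  refine ⟨π, hπ₁, hπ₂, le_trans ?_ (hπ _)⟩
  rw [Measure.finsetSum_apply]
  refine Finset.sum_le_sum fun i _ => ?_
  -- The marginals of `ρ i` are carried by `K i` and `U i`.
  have hcompl : ρ i (K i ×ˢ U i)ᶜ = 0 := by
    refine measure_mono_null (t := Prod.fst ⁻¹' (K i)ᶜ ∪ Prod.snd ⁻¹' (U i)ᶜ) ?_ ?_
    · intro p hp
      by_contra hcon
      simp only [Set.mem_union, Set.mem_preimage, Set.mem_compl_iff, not_or, not_not] at hcon
      exact hp hcon
    · refine measure_union_null ?_ ?_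
      · rw [← Measure.map_apply measurable_fst (hK i).compl, hρ₁]
        exact le_antisymm ((hμ' i _).trans (by simp [Measure.restrict_apply (hK i).compl]))
          zero_le
      · rw [← Measure.map_apply measurable_snd (hU i).compl, hρ₂]
        exact le_antisymm ((hν' i _).trans (by simp [Measure.restrict_apply (hU i).compl]))
          zero_le
  calc min (μ (K i)) (ν (U i)) = ρ i Set.univ := by
        rw [← hμc i, ← hρ₁ i, Measure.map_apply measurable_fst .univ, Set.preimage_univ]
    _ = ρ i (K i ×ˢ U i) := by
        rw [← measure_add_measure_compl ((hK i).prod (hU i)), hcompl, add_zero]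
    _ ≤ ρ i (⋃ i, K i ×ˢ U i) := measure_mono (Set.subset_iUnion (fun i => K i ×ˢ U i) i)

end Coupling

/-! ### Parameters -/

namespace MMSpace

/-- The endpoint `1` is null. This transfers the realisation of measures as images of `[0, 1]` to
the half-open interval. -/
theorem leb_map_inclusion :
    leb.map (Set.inclusion (Set.Ico_subset_Icc_self : Set.Ico (0 : ℝ) 1 ⊆ Set.Icc 0 1)) =
      (volume : Measure (Set.Icc (0 : ℝ) 1)) := by
  have hm : Measurable
      (Set.inclusion (Set.Ico_subset_Icc_self : Set.Ico (0 : ℝ) 1 ⊆ Set.Icc 0 1)) :=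
    measurable_inclusion _
  have hemb : MeasurableEmbedding (Subtype.val : Set.Icc (0 : ℝ) 1 → ℝ) :=
    .subtype_coe measurableSet_Icc
  have key : (leb.map (Set.inclusion (Set.Ico_subset_Icc_self : Set.Ico (0 : ℝ) 1 ⊆ _))).map
      Subtype.val = (volume : Measure (Set.Icc (0 : ℝ) 1)).map Subtype.val := by
    rw [Measure.map_map measurable_subtype_coe hm, Measure.Subtype.volume_def,
      (MeasurableEmbedding.subtype_coe measurableSet_Icc).map_comap, Subtype.range_coe,
      ← Measure.restrict_congr_set Ico_ae_eq_Icc]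
    change leb.map Subtype.val = _
    rw [leb, (MeasurableEmbedding.subtype_coe measurableSet_Ico).map_comap, Subtype.range_coe]
  rw [← hemb.comap_map (leb.map _), key, hemb.comap_map]

instance : IsProbabilityMeasure leb := by
  refine ⟨?_⟩
  have h := congrArg (fun m => m Set.univ) leb_map_inclusion
  simpa [Measure.map_apply (measurable_inclusion _) MeasurableSet.univ] using h

/-- Every Borel probability measure on a standard Borel space is an image of Lebesgue measure. -/
theorem exists_measurable_leb_map_eq {E : Type*} [MeasurableSpace E] [StandardBorelSpace E]
    (μ : Measure E) [IsProbabilityMeasure μ] :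
    ∃ φ : ParamInterval → E, Measurable φ ∧ leb.map φ = μ := by
  have : Nonempty E := nonempty_of_isProbabilityMeasure μ
  obtain ⟨f, hf, hfμ⟩ := μ.exists_measurable_map_eq
  refine ⟨f ∘ Set.inclusion Set.Ico_subset_Icc_self, hf.comp (measurable_inclusion _), ?_⟩
  rw [← Measure.map_map hf (measurable_inclusion _), leb_map_inclusion]
  exact hfμ

instance (X : MMSpace) : PolishSpace X where

theorem exists_isParameter (X : MMSpace) : ∃ φ, X.IsParameter φ :=
  exists_measurable_leb_map_eq X.μ

/-- In a second countable space the complement of the support is null, so nothing is lost by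
restricting to it. -/
theorem suppMeasure_map_val (X : MMSpace) : X.suppMeasure.map Subtype.val = X.μ := by
  have hs : MeasurableSet X.μ.support := Measure.isClosed_support.measurableSet
  have : HereditarilyLindelofSpace X := by
    have := UniformSpace.secondCountable_of_separable X
    infer_instance
  rw [suppMeasure, (MeasurableEmbedding.subtype_coe hs).map_comap, Subtype.range_coe]
  exact Measure.restrict_eq_self_of_ae_mem Measure.support_mem_ae

/-- Isomorphic mm-spaces are related by a measure preserving Borel map, isometric on the
support. -/
theorem Iso.exists_map {X Y : MMSpace} (h : Iso X Y) :
    ∃ g : X → Y, Measurable g ∧ X.μ.map g = Y.μ ∧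
      ∀ x ∈ X.μ.support, ∀ x' ∈ X.μ.support, dist (g x) (g x') = dist x x' := by
  obtain ⟨f, hf⟩ := h
  have : Nonempty Y := nonempty_of_isProbabilityMeasure Y.μ
  have hs : MeasurableSet X.μ.support := Measure.isClosed_support.measurableSet
  obtain ⟨g, hg, hgf⟩ := (MeasurableEmbedding.subtype_coe hs).exists_measurable_extend
    (g := fun x => (f x : Y)) (measurable_subtype_coe.comp hf.measurable) (fun _ => inferInstance)
  have hval : ∀ (x) (hx : x ∈ X.μ.support), g x = f ⟨x, hx⟩ := fun x hx =>
    congrFun hgf ⟨x, hx⟩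
  refine ⟨g, hg, ?_, fun x hx x' hx' => ?_⟩
  · rw [← X.suppMeasure_map_val, Measure.map_map hg measurable_subtype_coe, hgf]
    change X.suppMeasure.map (Subtype.val ∘ f) = _
    rw [← Measure.map_map measurable_subtype_coe hf.measurable, hf.map_eq, Y.suppMeasure_map_val]
  · rw [hval x hx, hval x' hx', ← Subtype.dist_eq, f.dist_eq]
    rfl

/-- Parameters can be transported along isomorphisms. -/
theorem Iso.exists_isParameter {X Y : MMSpace} (h : Iso X Y) {φ : ParamInterval → X}
    (hφ : X.IsParameter φ) : ∃ ψ, Y.IsParameter ψ ∧ ∃ A : Set ParamInterval, MeasurableSet A ∧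
      leb Aᶜ = 0 ∧ ∀ s ∈ A, ∀ t ∈ A, dist (ψ s) (ψ t) = dist (φ s) (φ t) := by
  obtain ⟨g, hg, hgμ, hgd⟩ := h.exists_map
  have hs : MeasurableSet X.μ.support := Measure.isClosed_support.measurableSet
  have : HereditarilyLindelofSpace X := by
    have := UniformSpace.secondCountable_of_separable X
    infer_instance
  refine ⟨g ∘ φ, ⟨hg.comp hφ.1, ?_⟩, φ ⁻¹' X.μ.support, hφ.1 hs, ?_,
    fun s hs t ht => hgd _ hs _ ht⟩
  · rw [← Measure.map_map hg hφ.1, hφ.2, hgμ]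
  · rw [← Set.preimage_compl, ← Measure.map_apply hφ.1 hs.compl, hφ.2]
    exact Measure.measure_compl_support

end MMSpace

/-! ### Box distance of classes and the choice of representatives -/

namespace MMClass

theorem box_mk_le (X Y : MMSpace) : box (mk X) (mk Y) ≤ X.box Y :=
  iInf₂_le_of_le X rfl (iInf₂_le_of_le Y rfl le_rfl)

/-- A bound on the box distance of classes gives parameters of any chosen representatives. -/
theorem exists_isParameter_of_box_lt {X Y : MMSpace} {r : ℝ}
    (h : box (mk X) (mk Y) < ENNReal.ofReal r) :
    ∃ φ ψ, X.IsParameter φ ∧ Y.IsParameter ψ ∧ ∃ I₀, MeasurableSet I₀ ∧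
      (∀ s ∈ I₀, ∀ t ∈ I₀, |dist (φ s) (φ t) - dist (ψ s) (ψ t)| ≤ r) ∧
      MMSpace.leb I₀ᶜ ≤ ENNReal.ofReal r := by
  simp only [box, MMSpace.box, MMSpace.boxParam, iInf_lt_iff] at h
  obtain ⟨X', hX, Y', hY, φ', hφ', ψ', hψ', ε, ⟨I, hI, hd, hm⟩, hε⟩ := h
  obtain ⟨φ, hφ, A, hA, hA0, hAd⟩ := (Quotient.exact hX : X'.Iso X).exists_isParameter hφ'
  obtain ⟨ψ, hψ, B, hB, hB0, hBd⟩ := (Quotient.exact hY : Y'.Iso Y).exists_isParameter hψ'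
  have hεr : (ε : ℝ) < r := by
    rwa [ENNReal.ofReal, ENNReal.coe_lt_coe, Real.lt_toNNReal_iff_coe_lt] at hε
  -- Changing representatives costs only the null sets `Aᶜ` and `Bᶜ`.
  refine ⟨φ, ψ, hφ, hψ, I ∩ (A ∩ B), hI.inter (hA.inter hB), ?_, ?_⟩
  · rintro s ⟨hs, hsA, hsB⟩ t ⟨ht, htA, htB⟩
    rw [hAd s hsA t htA, hBd s hsB t htB]
    exact (hd s hs t ht).trans hεr.le
  · rw [Set.compl_inter, Set.compl_inter]
    refine (measure_union_le _ _).trans ?_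
    rw [measure_union_null hA0 hB0, add_zero, ← ofReal_measureReal]
    refine ENNReal.ofReal_le_ofReal ?_
    rw [probReal_compl_eq_one_sub hI]
    linarith

end MMClass

/-! ### Almost Lipschitz maps -/

/-- A real function that is `1`-Lipschitz up to an additive error is close to a `1`-Lipschitz
function. -/
theorem exists_lipschitzWith_one_abs_sub_le {ι E : Type*} [PseudoMetricSpace E] (p : ι → E)
    (a : ι → ℝ) (S : Set ι) {ε : ℝ} (hε : 0 ≤ ε)
    (h : ∀ i ∈ S, ∀ j ∈ S, a i - a j ≤ dist (p i) (p j) + ε) :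
    ∃ g : E → ℝ, LipschitzWith 1 g ∧ ∀ i ∈ S, |g (p i) - a i| ≤ ε := by
  rcases S.eq_empty_or_nonempty with rfl | ⟨i₀, hi₀⟩
  · exact ⟨fun _ => 0, LipschitzWith.const' 0, by simp⟩
  have : Nonempty S := ⟨⟨i₀, hi₀⟩⟩
  have hbdd : ∀ x, BddBelow (Set.range fun j : S => a j + dist x (p j)) := by
    refine fun x => ⟨a i₀ - ε - dist x (p i₀), ?_⟩
    rintro _ ⟨j, rfl⟩
    have h₁ := h i₀ hi₀ j j.2
    have h₂ := dist_triangle_left (p i₀) (p j) x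
    simp only
    linarith
  -- McShane's formula. At `p i` the index `j = i` bounds the infimum above by `a i`, and the
  -- hypothesis bounds it below by `a i - ε`.
  refine ⟨fun x => ⨅ j : S, a j + dist x (p j), LipschitzWith.of_le_add fun x y => ?_,
    fun i hi => abs_le.2 ⟨?_, ?_⟩⟩
  · rw [← sub_le_iff_le_add]
    refine le_ciInf fun j => ?_
    have h₁ := ciInf_le (hbdd x) j
    have h₂ := dist_triangle x y (p j)
    linarith
  · rw [neg_le_sub_iff_le_add, ← sub_le_iff_le_add]
    refine le_ciInf fun j => ?_
    have h₁ := h i hi j j.2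
    linarith
  · have h₁ := ciInf_le (hbdd (p i)) ⟨i, hi⟩
    simp only [dist_self] at h₁
    linarith

/-- A map to `ℓ^∞` that is `1`-Lipschitz up to an additive error is close to a `1`-Lipschitz map. -/
theorem exists_lipschitzWith_one_dist_le {ι κ E : Type*} [PseudoMetricSpace E] [Fintype κ]
    (p : ι → E) (a : ι → κ → ℝ) (S : Set ι) {ε : ℝ} (hε : 0 ≤ ε)
    (h : ∀ i ∈ S, ∀ j ∈ S, dist (a i) (a j) ≤ dist (p i) (p j) + ε) :
    ∃ g : E → κ → ℝ, LipschitzWith 1 g ∧ ∀ i ∈ S, dist (g (p i)) (a i) ≤ ε := by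
  choose g hg hga using fun k => exists_lipschitzWith_one_abs_sub_le p (fun i => a i k) S hε
    fun i hi j hj => (le_abs_self _).trans
      ((dist_le_pi_dist (a i) (a j) k).trans (h i hi j hj))
  -- In the sup norm, neither the Lipschitz constant nor the error grows with the number of
  -- coordinates.
  exact ⟨fun x k => g k x, LipschitzWith.of_dist_le_mul fun x y =>
      (dist_pi_le_iff (by positivity)).2 fun k => (hg k).dist_le_mul x y,
    fun i hi => (dist_pi_le_iff hε).2 fun k => hga k i hi⟩

/-! ### Nearby measures -/

/-- Finitely many pairwise disjoint compact sets have pairwise disjoint thickenings. -/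
theorem exists_pairwise_disjoint_thickening {E ι : Type*} [MetricSpace E] [Finite ι]
    {K : ι → Set E}
    (hK : ∀ i, IsCompact (K i)) (hd : Pairwise (Function.onFun Disjoint K)) :
    ∃ δ > 0, ∀ r ≤ δ, Pairwise (Function.onFun Disjoint fun i => Metric.thickening r (K i)) := by
  have key : ∀ i j, ∀ᶠ r in 𝓝[>] (0 : ℝ), i ≠ j →
      Disjoint (Metric.thickening r (K i)) (Metric.thickening r (K j)) := by
    intro i j
    by_cases hij : i = j
    · simp [hij]
    obtain ⟨δ, hδ, h⟩ := (hd hij).exists_thickenings (hK i) (hK j).isClosed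
    filter_upwards [Ioc_mem_nhdsGT hδ] with r hr _
    exact h.mono (Metric.thickening_mono hr.2 _) (Metric.thickening_mono hr.2 _)
  have hall := (eventually_all.2 fun i => eventually_all.2 fun j => key i j).and
    self_mem_nhdsWithin
  obtain ⟨δ, hδ, hδ0⟩ := hall.exists
  exact ⟨δ, hδ0, fun r hr i j hij => (hδ i j hij).mono (Metric.thickening_mono hr _)
    (Metric.thickening_mono hr _)⟩

section Nearby

variable {E : Type*} [MetricSpace E] [MeasurableSpace E] [BorelSpace E]

/-- Off `Sᶜ`, a point that `u` sends into `B` is sent by `v` within `δ` of `B`. This turns pointwise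
closeness into a one-sided Prokhorov estimate. -/
theorem map_le_map_thickening_add {Ω : Type*} [MeasurableSpace Ω] (m : Measure Ω) {u v : Ω → E}
    (hu : Measurable u) (hv : Measurable v) {S : Set Ω} {δ : ℝ}
    (hd : ∀ ω ∈ S, dist (v ω) (u ω) < δ) {B : Set E} (hB : MeasurableSet B) :
    m.map u B ≤ m.map v (Metric.thickening δ B) + m Sᶜ := by
  rw [Measure.map_apply hu hB, Measure.map_apply hv Metric.isOpen_thickening.measurableSet]
  refine (measure_mono fun ω hω => ?_).trans (measure_union_le _ _)
  by_cases h : ω ∈ S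
  · exact Or.inl (Metric.mem_thickening_iff.2 ⟨u ω, hω, hd ω h⟩)
  · exact Or.inr h

/-- A probability measure is carried up to `η` by finitely many disjoint compact sets of diameter
at most `η`. -/
theorem exists_disjoint_isCompact_dist_le [CompleteSpace E] [SecondCountableTopology E]
    (μ : Measure E) [IsProbabilityMeasure μ] {η : ℝ} (hη : 0 < η) :
    ∃ (M : ℕ) (K : Fin M → Set E), (∀ j, IsCompact (K j)) ∧
      Pairwise (Function.onFun Disjoint K) ∧ (∀ j, ∀ x ∈ K j, ∀ y ∈ K j, dist x y ≤ η) ∧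
      1 ≤ ∑ j, μ (K j) + ENNReal.ofReal η := by
  have : Nonempty E := nonempty_of_isProbabilityMeasure μ
  set e := TopologicalSpace.denseSeq E
  set A : ℕ → Set E := disjointed fun i => Metric.ball (e i) (η / 2) with hA
  have hAm : ∀ i, MeasurableSet (A i) :=
    MeasurableSet.disjointed fun i => Metric.isOpen_ball.measurableSet
  have hAd : Pairwise (Function.onFun Disjoint A) := disjoint_disjointed _
  have hAU : ⋃ i, A i = Set.univ := by
    rw [hA, iUnion_disjointed, Set.eq_univ_iff_forall]
    intro x
    obtain ⟨i, hi⟩ := (TopologicalSpace.denseRange_denseSeq E).exists_dist_lt x (half_pos hη)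
    exact Set.mem_iUnion.2 ⟨i, hi⟩
  have hη2 : (0 : ℝ≥0∞) < ENNReal.ofReal (η / 2) := ENNReal.ofReal_pos.2 (half_pos hη)
  have hsum : Tendsto (fun n => ∑ i ∈ Finset.range n, μ (A i)) atTop (𝓝 1) := by
    have := ENNReal.tendsto_nat_tsum fun i => μ (A i)
    rwa [← measure_iUnion hAd hAm, hAU, measure_univ] at this
  obtain ⟨M, hM⟩ : ∃ M, 1 ≤ ∑ i ∈ Finset.range M, μ (A i) + ENNReal.ofReal (η / 2) := by
    have h1 : (1 : ℝ≥0∞) - ENNReal.ofReal (η / 2) < 1 :=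
      ENNReal.sub_lt_self ENNReal.one_ne_top one_ne_zero hη2.ne'
    obtain ⟨M, hM⟩ := (hsum.eventually (lt_mem_nhds h1)).exists
    exact ⟨M, tsub_le_iff_right.1 hM.le⟩
  -- Half of `η` pays for the tail of the partition; the other half is shared among the compact
  -- approximations of its first `M` pieces.
  have hδ : ENNReal.ofReal (η / 2) / (M + 1 : ℕ) ≠ 0 :=
    (ENNReal.div_pos hη2.ne' (ENNReal.natCast_ne_top _)).ne'
  choose K hKA hK hKμ using fun i => (hAm i).exists_isCompact_lt_add (measure_ne_top μ (A i)) hδ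
  refine ⟨M, fun j => K j, fun j => hK j, fun i j hij => ?_, fun j x hx y hy => ?_, ?_⟩
  · exact (hAd fun h => hij (Fin.ext h)).mono (hKA i) (hKA j)
  · have hx' := disjointed_subset _ _ (hKA _ hx)
    have hy' := disjointed_subset _ _ (hKA _ hy)
    have := dist_triangle_right x y (e j)
    rw [Metric.mem_ball] at hx' hy'
    linarith
  · calc (1 : ℝ≥0∞) ≤ ∑ i ∈ Finset.range M, μ (A i) + ENNReal.ofReal (η / 2) := hM
      _ ≤ ∑ i ∈ Finset.range M, (μ (K i) + ENNReal.ofReal (η / 2) / (M + 1 : ℕ)) +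
          ENNReal.ofReal (η / 2) := by
        gcongr with i
        exact (hKμ i).le
      _ = ∑ j : Fin M, μ (K j) + (M * (ENNReal.ofReal (η / 2) / (M + 1 : ℕ)) +
          ENNReal.ofReal (η / 2)) := by
        rw [Finset.sum_add_distrib, Finset.sum_const, Finset.card_range, nsmul_eq_mul, add_assoc,
          Finset.sum_range]
      _ ≤ ∑ j : Fin M, μ (K j) + ENNReal.ofReal η := by
        gcongr
        rw [← add_halves η, ENNReal.ofReal_add (half_pos hη).le (half_pos hη).le, add_halves]
        gcongr
        calc (M : ℝ≥0∞) * (ENNReal.ofReal (η / 2) / (M + 1 : ℕ))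
            ≤ ((M + 1 : ℕ) : ℝ≥0∞) * (ENNReal.ofReal (η / 2) / (M + 1 : ℕ)) := by
              gcongr
              exact Nat.le_succ M
          _ ≤ ENNReal.ofReal (η / 2) := ENNReal.mul_div_le

/-- Measures that are close in the sense of Prokhorov to a given one are images of Lebesgue measure
under maps that are close on a large set. -/
theorem exists_forall_leb_map_eq_dist_le [CompleteSpace E] [SecondCountableTopology E]
    (μ : Measure E) [IsProbabilityMeasure μ] {η : ℝ} (hη : 0 < η) :
    ∃ κ > 0, ∀ (ν : Measure E) [IsProbabilityMeasure ν],
      (∀ B, MeasurableSet B → μ B ≤ ν (Metric.thickening κ B) + ENNReal.ofReal κ) →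
      ∃ φ ψ : MMSpace.ParamInterval → E, Measurable φ ∧ Measurable ψ ∧
        MMSpace.leb.map φ = μ ∧ MMSpace.leb.map ψ = ν ∧ ∃ I₀, MeasurableSet I₀ ∧
          (∀ s ∈ I₀, dist (φ s) (ψ s) ≤ η) ∧ MMSpace.leb I₀ᶜ ≤ ENNReal.ofReal η := by
  obtain ⟨M, K, hK, hKd, hKη, hKμ⟩ := exists_disjoint_isCompact_dist_le μ (half_pos hη)
  obtain ⟨δ, hδ, hδd⟩ := exists_pairwise_disjoint_thickening hK hKd
  have hM : (0 : ℝ) < M + 1 := by positivity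
  -- `κ ≤ δ` keeps the thickenings disjoint. The second bound makes the total mass lost, `M * κ`,
  -- and the distance `κ` at most `η / 2` each. Neither bound involves `ν`.
  set κ := min δ (η / 2 / (M + 1)) with hκ
  have hκ0 : 0 < κ := lt_min hδ (by positivity)
  have hκη : (M + 1) * κ ≤ η / 2 := by
    rw [mul_comm, ← le_div_iff₀ hM]
    exact min_le_right _ _
  have hκη' : κ ≤ η / 2 := by nlinarith [mul_nonneg (Nat.cast_nonneg (α := ℝ) M) hκ0.le]
  refine ⟨κ, hκ0, fun ν _ hν => ?_⟩
  obtain ⟨π, hπ₁, hπ₂, hπ⟩ := exists_coupling_sum_min_le μ ν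
    (fun j => (hK j).isClosed.measurableSet)
    (fun j => (Metric.isOpen_thickening (δ := κ) (E := K j)).measurableSet) hKd
    (hδd κ (min_le_left _ _))
  have hπp : IsProbabilityMeasure π := by
    refine ⟨?_⟩
    have : π.map Prod.fst Set.univ = 1 := by rw [hπ₁, measure_univ]
    rwa [Measure.map_apply measurable_fst .univ] at this
  obtain ⟨χ, hχ, hχπ⟩ := MMSpace.exists_measurable_leb_map_eq π
  set R : Set (E × E) := ⋃ j, K j ×ˢ Metric.thickening κ (K j) with hR
  have hRm : MeasurableSet R := MeasurableSet.iUnion fun j =>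
    (hK j).isClosed.measurableSet.prod Metric.isOpen_thickening.measurableSet
  have hR1 : 1 ≤ π R + ENNReal.ofReal η := by
    calc (1 : ℝ≥0∞) ≤ ∑ j, μ (K j) + ENNReal.ofReal (η / 2) := hKμ
      _ ≤ ∑ j, (min (μ (K j)) (ν (Metric.thickening κ (K j))) + ENNReal.ofReal κ) +
          ENNReal.ofReal (η / 2) := by
        gcongr with j
        rw [min_add]
        exact le_min le_self_add (hν _ (hK j).isClosed.measurableSet)
      _ = ∑ j, min (μ (K j)) (ν (Metric.thickening κ (K j))) +
          (ENNReal.ofReal (M * κ) + ENNReal.ofReal (η / 2)) := by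
        rw [Finset.sum_add_distrib, Finset.sum_const, Finset.card_univ, Fintype.card_fin,
          nsmul_eq_mul, add_assoc, ENNReal.ofReal_mul (Nat.cast_nonneg _), ENNReal.ofReal_natCast]
      _ ≤ π R + ENNReal.ofReal η := by
        gcongr
        rw [← ENNReal.ofReal_add (by positivity) (by positivity)]
        exact ENNReal.ofReal_le_ofReal (by linarith)
  refine ⟨Prod.fst ∘ χ, Prod.snd ∘ χ, measurable_fst.comp hχ, measurable_snd.comp hχ, ?_, ?_,
    χ ⁻¹' R, hχ hRm, fun s hs => ?_, ?_⟩
  · rw [← Measure.map_map measurable_fst hχ, hχπ, hπ₁]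
  · rw [← Measure.map_map measurable_snd hχ, hχπ, hπ₂]
  · obtain ⟨j, hj₁, hj₂⟩ := Set.mem_iUnion.1 hs
    obtain ⟨z, hz, hzd⟩ := Metric.mem_thickening_iff.1 hj₂
    have h₁ := hKη j _ hj₁ z hz
    have h₂ := dist_triangle_right (χ s).1 (χ s).2 z
    simp only [Function.comp_apply]
    linarith
  · rw [← Set.preimage_compl, ← Measure.map_apply hχ hRm.compl, hχπ, prob_compl_eq_one_sub hRm]
    exact tsub_le_iff_left.2 hR1

end Nearby

namespace MMSpace

/-! ### Lipschitz images -/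

section LipschitzImage

variable {E : Type} [MetricSpace E] [CompleteSpace E] [TopologicalSpace.SeparableSpace E]
  [MeasurableSpace E] [BorelSpace E]

/-- The image of an mm-space under a `1`-Lipschitz map. -/
noncomputable def lipschitzImage (X : MMSpace) (F : X → E) (hF : LipschitzWith 1 F) : MMSpace :=
  have : IsProbabilityMeasure (X.μ.map F) :=
    Measure.isProbabilityMeasure_map hF.continuous.measurable.aemeasurable
  { carrier := E, μ := X.μ.map F }

theorem lipschitzImage_dominated (X : MMSpace) {F : X → E} (hF : LipschitzWith 1 F) :
    (X.lipschitzImage F hF).Dominated X :=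
  ⟨F, hF, rfl⟩

end LipschitzImage

theorem box_le_of_isParameter {X Y : MMSpace} {φ : ParamInterval → X} {ψ : ParamInterval → Y}
    (hφ : X.IsParameter φ) (hψ : Y.IsParameter ψ) {η : ℝ} (hη : 0 ≤ η) {I₀ : Set ParamInterval}
    (hI : MeasurableSet I₀)
    (hd : ∀ s ∈ I₀, ∀ t ∈ I₀, |dist (φ s) (φ t) - dist (ψ s) (ψ t)| ≤ η)
    (hm : leb I₀ᶜ ≤ ENNReal.ofReal η) : X.box Y ≤ ENNReal.ofReal η := by
  refine iInf₂_le_of_le φ hφ (iInf₂_le_of_le ψ hψ (iInf₂_le_of_le η.toNNReal ?_ le_rfl))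
  refine ⟨I₀, hI, ?_, ?_⟩
  · rwa [Real.coe_toNNReal _ hη]
  · have h₁ : leb.real I₀ᶜ ≤ η := ENNReal.toReal_le_of_le_ofReal hη hm
    rw [probReal_compl_eq_one_sub hI] at h₁
    rw [Real.coe_toNNReal _ hη]
    linarith

/-- Every mm-space is approximated by its `1`-Lipschitz images in finite dimensional `ℓ^∞`
spaces. -/
theorem exists_box_lipschitzImage_le (Y : MMSpace) {r : ℝ} (hr : 0 < r) :
    ∃ (N : ℕ) (F : Y → Fin N → ℝ) (hF : LipschitzWith 1 F),
      Y.box (Y.lipschitzImage F hF) ≤ ENNReal.ofReal r := by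
  have : Nonempty Y := nonempty_of_isProbabilityMeasure Y.μ
  obtain ⟨φ, hφ⟩ := Y.exists_isParameter
  set e := TopologicalSpace.denseSeq Y
  set A : ℕ → Set Y := fun n => ⋃ i : Fin n, Metric.ball (e i) (r / 2) with hA
  have hAm : ∀ n, MeasurableSet (A n) := fun n =>
    (isOpen_iUnion fun i => Metric.isOpen_ball).measurableSet
  have hlim : Tendsto (fun n => Y.μ (A n)ᶜ) atTop (𝓝 0) := by
    have hanti : Antitone fun n => (A n)ᶜ := by
      intro m n hmn
      refine Set.compl_subset_compl.2 (Set.iUnion_subset fun i => ?_)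
      exact Set.subset_iUnion_of_subset (Fin.castLE hmn i) le_rfl
    have hempty : ⋂ n, (A n)ᶜ = ∅ := by
      rw [← Set.compl_iUnion, Set.compl_empty_iff, Set.eq_univ_iff_forall]
      intro x
      obtain ⟨i, hi⟩ := (TopologicalSpace.denseRange_denseSeq Y).exists_dist_lt x (half_pos hr)
      exact Set.mem_iUnion.2 ⟨i + 1, Set.mem_iUnion.2 ⟨Fin.last i, hi⟩⟩
    have := tendsto_measure_iInter_atTop (μ := Y.μ)
      (fun n => (hAm n).compl.nullMeasurableSet) hanti ⟨0, measure_ne_top _ _⟩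
    rwa [hempty, measure_empty] at this
  obtain ⟨N, hN⟩ := (hlim.eventually (gt_mem_nhds (ENNReal.ofReal_pos.2 hr))).exists
  have hF : LipschitzWith 1 fun (y : Y) (i : Fin N) => dist y (e i) :=
    LipschitzWith.of_dist_le_mul fun x y => (dist_pi_le_iff (by positivity)).2 fun i =>
      (LipschitzWith.dist_left (e i)).dist_le_mul x y
  have hFm := hF.continuous.measurable
  refine ⟨N, _, hF, box_le_of_isParameter hφ (ψ := fun s => (fun (y : Y) (i : Fin N) =>
    dist y (e i)) (φ s)) ⟨hFm.comp hφ.1, ?_⟩ hr.le (hφ.1 (hAm N)) ?_ ?_⟩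
  · change leb.map ((fun (y : Y) (i : Fin N) => dist y (e i)) ∘ φ) = _
    rw [← Measure.map_map hFm hφ.1, hφ.2]
    rfl
  -- If `φ s` is within `r / 2` of `e i`, the `i`-th coordinates of the images differ by at least
  -- `dist (φ s) (φ t) - r`; `F` never increases distances.
  · intro s hs t ht
    obtain ⟨i, hi⟩ := Set.mem_iUnion.1 hs
    have h₁ := hF.dist_le_mul (φ s) (φ t)
    have h₂ : |dist (φ s) (e i) - dist (φ t) (e i)| ≤
        dist (fun i : Fin N => dist (φ s) (e i)) (fun i : Fin N => dist (φ t) (e i)) :=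
      dist_le_pi_dist (fun i : Fin N => dist (φ s) (e i)) (fun i : Fin N => dist (φ t) (e i)) i
    have h₃ := (abs_le.1 h₂).1
    have h₄ := dist_triangle_right (φ s) (φ t) (e i)
    rw [Metric.mem_ball] at hi
    simp only [NNReal.coe_one, one_mul] at h₁
    refine abs_le.2 ⟨?_, ?_⟩
    · refine le_trans (by linarith : -r ≤ 0) (sub_nonneg.2 h₁)
    · rw [sub_le_iff_le_add]
      refine le_trans (by linarith : _ ≤ r + dist (fun i : Fin N => dist (φ s) (e i))
        (fun i : Fin N => dist (φ t) (e i))) le_rfl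
  · rw [← Set.preimage_compl, ← Measure.map_apply hφ.1 (hAm N).compl, hφ.2]
    exact hN.le

/-- A `1`-Lipschitz map from `Y` to `ℓ^∞` is matched, up to a small Prokhorov error, by one from any
`X` that approximately dominates a space close to `Y`. -/
theorem ApproxDominated.exists_lipschitzWith_map_le {X Y Y' : MMSpace} {N : ℕ}
    {F : Y → Fin N → ℝ} (hF : LipschitzWith 1 F) {κ ε : ℝ} (hκ : 0 < κ)
    (hbox : MMClass.box (MMClass.mk Y) (MMClass.mk Y') < ENNReal.ofReal (κ / 4))
    (hε0 : 0 ≤ ε) (hε : ε < κ / 4) (hdom : ApproxDominated ε Y' X) :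
    ∃ G : X → Fin N → ℝ, LipschitzWith 1 G ∧ ∀ B, MeasurableSet B →
      Y.μ.map F B ≤ X.μ.map G (Metric.thickening κ B) + ENNReal.ofReal κ := by
  obtain ⟨ψ, φ, hψ, hφ, I₀, hI, hId, hIm⟩ := MMClass.exists_isParameter_of_box_lt hbox
  obtain ⟨S, f, hS, hf, hSm, hSd, hLP⟩ := hdom
  have hκ4 : (0 : ℝ) ≤ κ / 4 := by positivity
  -- Through the parameters, `F` is seen as an almost `1`-Lipschitz map on the points `φ s` of `Y'`.
  obtain ⟨H, hH, hHd⟩ := exists_lipschitzWith_one_dist_le φ (F ∘ ψ) I₀ hκ4 fun s hs t ht => by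
    have h₁ := hF.dist_le_mul (ψ s) (ψ t)
    have h₂ := (abs_le.1 (hId s hs t ht)).2
    simp only [NNReal.coe_one, one_mul] at h₁
    exact h₁.trans (by linarith)
  obtain ⟨G, hG, hGd⟩ := exists_lipschitzWith_one_dist_le id (H ∘ f) S hε0 fun x hx y hy => by
    have h₁ := hH.dist_le_mul (f x) (f y)
    simp only [NNReal.coe_one, one_mul] at h₁
    exact h₁.trans (hSd x hx y hy)
  have hFm := hF.continuous.measurable
  have hHm := hH.continuous.measurable
  have hGm := hG.continuous.measurable
  refine ⟨G, hG, fun B hB => ?_⟩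
  -- Three comparisons follow: `F` with `H`, `H` with `H ∘ f`, and `H ∘ f` with `G`. Each costs `κ /
  -- 3` in radius and in mass; the margin over `κ / 4` supplies the strict inequalities.
  set δ := κ / 3 with hδ
  have hδ0 : 0 < δ := by positivity
  have step₁ : Y.μ.map F B ≤ Y'.μ.map H (Metric.thickening δ B) + ENNReal.ofReal δ := by
    rw [← hψ.2, ← hφ.2, Measure.map_map hFm hψ.1, Measure.map_map hHm hφ.1]
    refine (map_le_map_thickening_add leb (hFm.comp hψ.1) (hHm.comp hφ.1) (S := I₀) (δ := δ)
      (fun s hs => (hHd s hs).trans_lt (by linarith)) hB).trans ?_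
    gcongr
    exact hIm.trans (ENNReal.ofReal_le_ofReal (by linarith))
  have step₂ : ∀ A, MeasurableSet A →
      Y'.μ.map H A ≤ X.μ.map (H ∘ f) (Metric.thickening δ A) + ENNReal.ofReal δ := by
    intro A hA
    have : IsProbabilityMeasure (X.μ.map f) := Measure.isProbabilityMeasure_map hf.aemeasurable
    have hlt : levyProkhorovEDist (X.μ.map f) Y'.μ < ENNReal.ofReal δ := by
      rw [← ENNReal.ofReal_toReal (levyProkhorovEDist_ne_top (X.μ.map f) Y'.μ)]
      exact (ENNReal.ofReal_lt_ofReal_iff hδ0).2 (hLP.trans_lt (by linarith))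
    rw [Measure.map_apply hHm hA]
    refine (right_measure_le_of_levyProkhorovEDist_lt hlt (hHm hA)).trans ?_
    rw [ENNReal.toReal_ofReal hδ0.le, ← Measure.map_map hHm hf,
      Measure.map_apply hHm Metric.isOpen_thickening.measurableSet]
    gcongr
    -- A `1`-Lipschitz map sends the thickening of a preimage into the thickening, so `H` preserves
    -- the Prokhorov estimate.
    intro y hy
    obtain ⟨z, hz, hzd⟩ := Metric.mem_thickening_iff.1 hy
    refine Metric.mem_thickening_iff.2 ⟨H z, hz, ?_⟩
    have h₁ := hH.dist_le_mul y z
    simp only [NNReal.coe_one, one_mul] at h₁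
    exact h₁.trans_lt hzd
  have step₃ : ∀ A, MeasurableSet A →
      X.μ.map (H ∘ f) A ≤ X.μ.map G (Metric.thickening δ A) + ENNReal.ofReal δ := by
    intro A hA
    refine (map_le_map_thickening_add X.μ (hHm.comp hf) hGm (S := S) (δ := δ)
      (fun x hx => (hGd x hx).trans_lt (by linarith)) hA).trans ?_
    gcongr
    rw [← ofReal_measureReal, probReal_compl_eq_one_sub hS]
    exact ENNReal.ofReal_le_ofReal (by linarith)
  have hsub : Metric.thickening δ (Metric.thickening δ (Metric.thickening δ B)) ⊆
      Metric.thickening κ B := by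
    refine (Metric.thickening_subset_of_subset _ (Metric.thickening_thickening_subset _ _ _)).trans
      ((Metric.thickening_thickening_subset _ _ _).trans (Metric.thickening_mono ?_ _))
    linarith
  have hsum : ENNReal.ofReal δ + ENNReal.ofReal δ + ENNReal.ofReal δ = ENNReal.ofReal κ := by
    rw [← ENNReal.ofReal_add hδ0.le hδ0.le, ← ENNReal.ofReal_add (by linarith) hδ0.le]
    congr 1
    linarith
  calc Y.μ.map F B ≤ _ := step₁
    _ ≤ _ := add_le_add_left ((step₂ _ Metric.isOpen_thickening.measurableSet).trans
        (add_le_add_left (step₃ _ Metric.isOpen_thickening.measurableSet) _)) _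
    _ ≤ X.μ.map G (Metric.thickening κ B) + ENNReal.ofReal κ := by
        rw [← hsum, add_assoc, add_assoc, ← add_assoc (ENNReal.ofReal δ)]
        gcongr

end MMSpace

/-! ### The limit argument -/

theorem proposition3p9
    (ε : ℕ → ℝ) (hε_pos : ∀ n, 0 < ε n) (hε : Tendsto ε atTop (𝓝 0))
    (P Q : ℕ → Set MMClass) (Plim Qlim : Set MMClass)
    (hP : ∀ n, IsPyramid (P n)) (hQ : ∀ n, IsPyramid (Q n))
    (hPlim : IsPyramid Plim) (hQlim : IsPyramid Qlim)
    (hPconv : WeaklyConverges P Plim) (hQconv : WeaklyConverges Q Qlim)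
    (hdom : ∀ n, PyramidApproxDominated (ε n) (Q n) (P n)) :
    Qlim ⊆ Plim := by
  intro b hb
  obtain ⟨Y, rfl⟩ : ∃ Y, MMClass.mk Y = b := Quotient.exists_rep b
  by_contra hbP
  obtain ⟨r, hr, hball⟩ := hPlim.isClosed.isOpen_compl (MMClass.mk Y) hbP
  obtain ⟨r', hr'0, hr'⟩ : ∃ r' : ℝ, 0 < r' ∧ ENNReal.ofReal r' < r := by
    obtain ⟨q, hq0, hq⟩ := ENNReal.lt_iff_exists_nnreal_btwn.1 hr
    exact ⟨q, by exact_mod_cast hq0, by rwa [ENNReal.ofReal_coe_nnreal]⟩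
  obtain ⟨N, F, hF, hFbox⟩ := Y.exists_box_lipschitzImage_le hr'0
  have hZ : MMClass.mk (Y.lipschitzImage F hF) ∉ Plim :=
    hball _ ((MMClass.box_mk_le _ _).trans_lt (hFbox.trans_lt hr'))
  obtain ⟨c, hc0, hc⟩ := ENNReal.lt_iff_exists_nnreal_btwn.1 (hPconv.2 _ hZ)
  have hc0' : (0 : ℝ) < c := by exact_mod_cast hc0
  have hev := eventually_lt_of_lt_liminf hc
  have hprob : IsProbabilityMeasure (Y.μ.map F) :=
    Measure.isProbabilityMeasure_map hF.continuous.measurable.aemeasurable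
  -- `κ` depends only on `c` and the law of `F`, so it is fixed before `n`. Moving both endpoints by
  -- `c / 2` changes a distance by at most `c`.
  obtain ⟨κ, hκ, hκν⟩ := exists_forall_leb_map_eq_dist_le (Y.μ.map F) (half_pos hc0')
  have hκ4 : 0 < κ / 4 := by positivity
  obtain ⟨n, hn₁, hn₂, hn₃⟩ := (hev.and (((hQconv.1 _ hb).eventually
    (gt_mem_nhds (ENNReal.ofReal_pos.2 hκ4))).and (hε.eventually (gt_mem_nhds hκ4)))).exists
  simp only [MMClass.boxToSet, iInf_lt_iff] at hn₂
  obtain ⟨b', hb', hbox⟩ := hn₂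
  obtain ⟨a, ha, Y', X, rfl, rfl, hYX⟩ := hdom n b' hb'
  obtain ⟨G, hG, hGB⟩ := hYX.exists_lipschitzWith_map_le hF hκ hbox (hε_pos n).le hn₃
  have hprob' : IsProbabilityMeasure (X.μ.map G) :=
    Measure.isProbabilityMeasure_map hG.continuous.measurable.aemeasurable
  obtain ⟨φ, ψ, hφm, hψm, hφ, hψ, I₀, hI, hId, hIm⟩ := hκν (X.μ.map G) hGB
  have hmem : MMClass.mk (X.lipschitzImage G hG) ∈ P n :=
    (hP n).downward _ ha _ ⟨_, X, rfl, rfl, X.lipschitzImage_dominated hG⟩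
  have hle : (Y.lipschitzImage F hF).box (X.lipschitzImage G hG) ≤ ENNReal.ofReal c := by
    refine MMSpace.box_le_of_isParameter (X := Y.lipschitzImage F hF)
      (Y := X.lipschitzImage G hG) (φ := φ) (ψ := ψ) ⟨hφm, hφ⟩ ⟨hψm, hψ⟩ hc0'.le hI
      (fun s hs t ht => ?_) (hIm.trans (ENNReal.ofReal_le_ofReal (by linarith)))
    have h₁ := dist_dist_dist_le (φ s) (φ t) (ψ s) (ψ t)
    have h₂ := hId s hs
    have h₃ := hId t ht
    exact h₁.trans (by linarith)
  refine absurd hn₁ (not_lt.2 ?_)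
  rw [← ENNReal.ofReal_coe_nnreal]
  exact iInf₂_le_of_le _ hmem ((MMClass.box_mk_le _ _).trans hle)
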